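/- Let $\mathcal M=(Q,X,\cdot,\circ)$ be a finite Mealy automaton, i.e. $Q$ (states) and $X$ (letters) are finite sets and $\cdot:Q\times X\to Q$, $\circ:Q\times X\to X$ are maps; write $q\xrightarrow{a|b}p$ when $q\cdot a=p$ and $q\circ a=b$. Suppose that $\mathcal M$ is bireversible: each state $q$ induces a permutation $a\mapsto q\circ a$ of $X$, each input letter $a$ induces a permutation $q\mapsto q\cdot a$ of $Q$, and each output letter induces a permutation of $Q$ (if $q\xrightarrow{a|b}p$ and $q'\xrightarrow{c|b}p$, then $q=q'$). Let $G(\mathcal M)$ be the group of permutations of the set $X^*$ of finite words generated by the maps $u\mapsto q\circ u$, $q\in Q$, where $q\circ(au)=(q\circ a)\,((q\cdot a)\circ u)$. Let $G(\mathfrak d\mathcal M)$ be the group generated in the same way by the dual automaton $\mathfrak d\mathcal M=(X,Q,\circ,\cdot)$, whose transitions are $a\xrightarrow{q|p}b$ for $q\xrightarrow{a|b}p$ in $\mathcal M$. Adding to $\mathcal M$ a transition $p\xrightarrow{a^{-1}|b^{-1}}q$ for each $q\xrightarrow{a|b}p$, one obtains maps $w\mapsto q\circ w$ of the free group $F_X$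 to itself and states $q\cdot w\in Q$, for $q\in Q$ and $w\in F_X$. Assume that $G(\mathcal M)$ is infinite and that $G(\mathfrak d\mathcal M)$ is not a free group (of any rank, including $0$). Then there is a monomorphism $\phi:G(\mathcal M)\hookrightarrow \mathrm{Out}(F_\infty)$, where $F_\infty$ is the free group of countably infinite rank and $\mathrm{Out}(H)=\mathrm{Aut}(H)/\mathrm{Inn}(H)$. More precisely, among the subsets $S\subseteq F_X$ such that $q\circ w\in S$ and $q\cdot w=q$ for all $w\in S$ and $q\in Q$ there is a largest one, $N$. It is a normal subgroup of infinite index in $F_X$, it is the kernel of the canonical map from $F_X$ onto $G(\mathfrak d\mathcal M)$ (with words over $X$ acting on words over $Q$ from the right), and it is isomorphic to $F_\infty$. There is a homomorphism $\psi:G(\mathcal M)\to\mathrm{Aut}(N)$ with $\psi(q)(n)=q\circ n$ for all $q\in Q$ and $n\in N$, such that $\psi(g)$ is not inner for every $g\ne 1$; and, for a suitable isomorphism $N\cong F_\infty$, $\phi$ is the composition of $\psi$ with $\mathrm{Aut}(N)\to\mathrm{Out}(N)\cong\mathrm{Out}(F_\infty)$. -/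

import Mathlib

/-- A Mealy automaton with stateset `Q` and alphabet `X`; a transition `q --a|b--> p` means
`M.next q a = p` and `M.out q a = b`. -/
structure MealyAutomaton (Q X : Type*) where
  /-- the transition function `q · a` -/
  next : Q → X → Q
  /-- the production function `q ∘ a` -/
  out : Q → X → X

namespace MealyAutomaton

/-- The dual automaton: `a --q|p--> b` whenever `q --a|b--> p`. -/
def dual {Q X : Type*} (M : MealyAutomaton Q X) : MealyAutomaton X Q where
  next a q := M.out q a
  out a q := M.next q a

/-- Every state induces a permutation of the alphabet. -/
def IsInvertible {Q X : Type*} (M : MealyAutomaton Q X) : Prop :=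
  ∀ q, Function.Bijective (M.out q)

/-- Every input letter induces a permutation of the stateset. -/
def IsReversible {Q X : Type*} (M : MealyAutomaton Q X) : Prop :=
  ∀ a, Function.Bijective (fun q => M.next q a)

/-- Invertible, reversible, and every output letter induces a permutation of the (finite) stateset:
two transitions `q --a|b--> p` and `q' --c|b--> p` have `q = q'`. -/
structure IsBireversible {Q X : Type*} (M : MealyAutomaton Q X) : Prop where
  invertible : M.IsInvertible
  reversible : M.IsReversible
  output_injective : ∀ q q' a c, M.next q a = M.next q' c → M.out q a = M.out q' c → q = q'

/-- The map `u ↦ q ∘ u` on finite words. -/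
def act {Q X : Type*} (M : MealyAutomaton Q X) : Q → List X → List X
  | _, [] => []
  | q, a :: u => M.out q a :: M.act (M.next q a) u

/-- The state `q · u` reached from `q` by reading the finite word `u`. -/
def run {Q X : Type*} (M : MealyAutomaton Q X) : Q → List X → Q
  | q, [] => q
  | q, a :: u => M.run (M.next q a) u

theorem act_bijective {Q X : Type*} {M : MealyAutomaton Q X} (h : M.IsInvertible) (q : Q) :
    Function.Bijective (M.act q) := by
  constructor
  · intro u
    induction u generalizing q with
    | nil => intro v hv; cases v <;> simp_all [act]
    | cons a u ih =>
      intro v hv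
      cases v with
      | nil => simp [act] at hv
      | cons b v =>
        simp only [act, List.cons.injEq] at hv
        obtain rfl := (h q).1 hv.1
        rw [ih _ hv.2]
  · intro u
    induction u generalizing q with
    | nil => exact ⟨[], rfl⟩
    | cons b u ih =>
      obtain ⟨a, rfl⟩ := (h q).2 b
      obtain ⟨v, rfl⟩ := ih (M.next q a)
      exact ⟨a :: v, rfl⟩

/-- The permutation `u ↦ q ∘ u` of the set of finite words. -/
noncomputable def statePerm {Q X : Type*} (M : MealyAutomaton Q X) (h : M.IsInvertible) (q : Q) :
    Equiv.Perm (List X) :=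
  Equiv.ofBijective (M.act q) (act_bijective h q)

/-- The automaton group: the group of transformations of the set of finite words generated by the
states. -/
def autGroup {Q X : Type*} (M : MealyAutomaton Q X) (h : M.IsInvertible) :
    Subgroup (Equiv.Perm (List X)) :=
  Subgroup.closure (Set.range (M.statePerm h))

/-- The generator of the automaton group given by a state. -/
noncomputable def gen {Q X : Type*} (M : MealyAutomaton Q X) (h : M.IsInvertible) (q : Q) :
    M.autGroup h :=
  ⟨M.statePerm h q, Subgroup.subset_closure ⟨q, rfl⟩⟩

/-- The permutation `q ↦ q · a` of the stateset of a reversible automaton. -/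
noncomputable def letterPerm {Q X : Type*} (M : MealyAutomaton Q X) (h : M.IsReversible) (a : X) :
    Equiv.Perm Q :=
  Equiv.ofBijective (fun q => M.next q a) (h a)

/-- The enriched automaton over `X ∪ X⁻¹`: to the transitions `q --a|b--> p` of `M` one adds
`p --a⁻¹|b⁻¹--> q`. The letter `a` is `(a, true)` and `a⁻¹` is `(a, false)`. -/
noncomputable def enriched {Q X : Type*} (M : MealyAutomaton Q X) (h : M.IsReversible) :
    MealyAutomaton Q (X × Bool) where
  next p x := if x.2 then M.next p x.1 else (M.letterPerm h x.1).symm p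
  out p x := if x.2 then (M.out p x.1, true) else (M.out ((M.letterPerm h x.1).symm p) x.1, false)

theorem enriched_cancel {Q X : Type*} (M : MealyAutomaton Q X) (h : M.IsReversible)
    (q : Q) (a : X) (b : Bool) :
    (M.enriched h).next ((M.enriched h).next q (a, b)) (a, !b) = q ∧
    (M.enriched h).out ((M.enriched h).next q (a, b)) (a, !b) =
      (((M.enriched h).out q (a, b)).1, !b) ∧
    ((M.enriched h).out q (a, b)).2 = b := by
  have h1 : ∀ p, (M.letterPerm h a).symm (M.next p a) = p :=
    fun p => (M.letterPerm h a).symm_apply_apply p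
  have h2 : M.next ((M.letterPerm h a).symm q) a = q := (M.letterPerm h a).apply_symm_apply q
  cases b <;> simp [enriched, h1, h2]

theorem enriched_step {Q X : Type*} (M : MealyAutomaton Q X) (h : M.IsReversible) (q : Q)
    (u v : List (X × Bool)) (huv : FreeGroup.Red.Step u v) :
    FreeGroup.Red.Step ((M.enriched h).act q u) ((M.enriched h).act q v) ∧
    (M.enriched h).run q u = (M.enriched h).run q v := by
  obtain @⟨L₁, L₂, a, b⟩ := huv
  induction L₁ generalizing q with
  | nil =>
    obtain ⟨h1, h2, h3⟩ := M.enriched_cancel h q a b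
    simp only [List.nil_append, act, run, h1, h2, and_true]
    have h4 : (M.enriched h).out q (a, b) = (((M.enriched h).out q (a, b)).1, b) :=
      Prod.ext rfl h3
    rw [h4]
    exact FreeGroup.Red.Step.cons_not
  | cons c L ih => exact ⟨(ih _).1.cons, (ih _).2⟩

/-- The map `w ↦ q ∘ w` on the free group `F_X`. -/
noncomputable def freeAct {Q X : Type*} (M : MealyAutomaton Q X) (h : M.IsReversible) (q : Q) :
    FreeGroup X → FreeGroup X :=
  Quot.map ((M.enriched h).act q) (fun u v huv => (M.enriched_step h q u v huv).1)

/-- The state `q · w` for `w` in the free group `F_X`. -/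
noncomputable def freeRun {Q X : Type*} (M : MealyAutomaton Q X) (h : M.IsReversible) (q : Q) :
    FreeGroup X → Q :=
  Quot.lift ((M.enriched h).run q) (fun u v huv => (M.enriched_step h q u v huv).2)

/-- The canonical homomorphism from `F_X` to the group generated by the dual automaton. As words
over `X` act on words over `Q` from the right, it takes values in the opposite group. -/
noncomputable def dualHom {Q X : Type*} (M : MealyAutomaton Q X) (h : M.IsReversible) :
    FreeGroup X →* (M.dual.autGroup h)ᵐᵒᵖ :=
  FreeGroup.lift (fun a => MulOpposite.op (M.dual.gen h a))

end MealyAutomaton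

/-- The group of inner automorphisms. -/
def Inn (G : Type*) [Group G] : Subgroup (MulAut G) := (MulAut.conj : G →* MulAut G).range

instance Inn.normal (G : Type*) [Group G] : (Inn G).Normal := by
  refine ⟨?_⟩
  rintro _ ⟨x, rfl⟩ f
  refine ⟨f x, ?_⟩
  ext y
  simp [MulAut.conj_apply]

/-- The outer automorphism group. -/
abbrev Out (G : Type*) [Group G] : Type _ := MulAut G ⧸ Inn G

/-! ### The enriched automaton on reduced words -/

namespace MealyAutomaton

variable {Q X : Type*}

/-! States preserve reduced length. Bireversibility makes the enriched automaton invertible, and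
reading x then x⁻¹ outputs some y then y⁻¹, so states map reduced words injectively to reduced words
of the same length (`toWord_freeAct`). On the kernel N of `dualHom` every state returns to itself,
so the rule `freeAct_mul` turns each state into an injective endomorphism of N, bijective because
there are finitely many words of each length.

A relation of G(M) is only known to fix the words over X. It fixes those over X ∪ X⁻¹ too: on formal
products of states of a given length, a letter a acts as a permutation of a finite set, so a⁻¹ acts
on each product as some nonnegative power of a (`wordAutomaton_act_eq_self`). Hence ψ is well
defined.

N is nontrivial since the dual group is not free, and X has two letters since G(M) is infinite. So
every reduced word u begins some n = u m u⁻¹ in N, reduced as written (`exists_mem_ker_toWord`).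
Comparing prefixes shows that ψ is injective. If ψ(g) were conjugation by k ≠ 1, then with u = k it
would send m to the longer n, against the preservation of length. If N were finitely generated, the
generators would have finitely many possible images, and G(M) would be finite. So N has infinite
index and countably infinite rank. -/

theorem act_length (M : MealyAutomaton Q X) (q : Q) (u : List X) :
    (M.act q u).length = u.length := by
  induction u generalizing q with
  | nil => rfl
  | cons a u ih => simp [act, ih]

theorem act_append (M : MealyAutomaton Q X) (q : Q) (u v : List X) :
    M.act q (u ++ v) = M.act q u ++ M.act (M.run q u) v := by
  induction u generalizing q with
  | nil => rfl
  | cons a u ih => simp [act, run, ih]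

theorem run_append (M : MealyAutomaton Q X) (q : Q) (u v : List X) :
    M.run q (u ++ v) = M.run (M.run q u) v := by
  induction u generalizing q with
  | nil => rfl
  | cons a u ih => simp [run, ih]

/-- Outputs keep the sign of a letter. On inverse letters, injectivity is where the condition on
output letters enters. -/
theorem IsBireversible.enriched_isInvertible [Finite X] {M : MealyAutomaton Q X}
    (hM : M.IsBireversible) : (M.enriched hM.reversible).IsInvertible := by
  intro p
  rw [← Finite.injective_iff_bijective]
  rintro ⟨a, b⟩ ⟨c, d⟩ h
  have hb := (M.enriched_cancel hM.reversible p a b).2.2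
  have hd := (M.enriched_cancel hM.reversible p c d).2.2
  have hbd : b = d := by rw [← hb, ← hd, h]
  subst hbd
  cases b
  · simp only [enriched, Bool.false_eq_true, if_false, Prod.mk.injEq, and_true] at h
    have h1 := (M.letterPerm hM.reversible a).apply_symm_apply p
    have h2 := (M.letterPerm hM.reversible c).apply_symm_apply p
    have hq := hM.output_injective _ _ a c (h1.trans h2.symm) h
    rw [hq] at h
    rw [(hM.invertible _).1 h]
  · simp only [enriched, if_true, Prod.mk.injEq, and_true] at h
    rw [(hM.invertible p).1 h]

/-- The permutations of words over `X ∪ X⁻¹` given by the states of the enriched automaton. -/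
noncomputable def enrichedPerm [Finite X] {M : MealyAutomaton Q X} (hM : M.IsBireversible) (q : Q) :
    Equiv.Perm (List (X × Bool)) :=
  (M.enriched hM.reversible).statePerm hM.enriched_isInvertible q

/-- After x, the inverse of the output of x is produced by x⁻¹, and by invertibility by no other
letter, so cancelling outputs come only from cancelling inputs. -/
theorem enriched_act_isReduced [Finite X] {M : MealyAutomaton Q X} (hM : M.IsBireversible) (q : Q)
    {u : List (X × Bool)} (hu : FreeGroup.IsReduced u) :
    FreeGroup.IsReduced ((M.enriched hM.reversible).act q u) := by
  induction u generalizing q with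
  | nil => exact FreeGroup.IsReduced.nil
  | cons x u ih =>
    cases u with
    | nil => exact FreeGroup.IsReduced.singleton
    | cons y u =>
      rw [FreeGroup.isReduced_cons_cons] at hu
      have := ih ((M.enriched hM.reversible).next q x) hu.2
      simp only [act] at this ⊢
      rw [FreeGroup.isReduced_cons_cons]
      refine ⟨fun h1 => ?_, this⟩
      by_contra h2
      obtain ⟨-, h3, h4⟩ := M.enriched_cancel hM.reversible q x.1 x.2
      have h5 : (M.enriched hM.reversible).out ((M.enriched hM.reversible).next q x) y =
          (M.enriched hM.reversible).out ((M.enriched hM.reversible).next q x) (x.1, !x.2) := by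
        rw [h3]
        refine Prod.ext h1.symm ?_
        have h4' : ((M.enriched hM.reversible).out q x).2 = x.2 := h4
        rw [h4'] at h2
        exact Bool.eq_not.mpr (Ne.symm h2)
      have h6 := (hM.enriched_isInvertible _).1 h5
      subst h6
      simpa using hu.1

theorem toWord_freeAct [Finite X] [DecidableEq X] {M : MealyAutomaton Q X} (hM : M.IsBireversible)
    (q : Q) (w : FreeGroup X) :
    (M.freeAct hM.reversible q w).toWord = (M.enriched hM.reversible).act q w.toWord := by
  conv_lhs => rw [← FreeGroup.mk_toWord (x := w)]
  change (FreeGroup.mk ((M.enriched hM.reversible).act q w.toWord)).toWord = _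
  rw [FreeGroup.toWord_mk,
    (enriched_act_isReduced hM q FreeGroup.isReduced_toWord).reduce_eq]

/-! ### The kernel of the dual action -/

theorem freeAct_mul (M : MealyAutomaton Q X) (h : M.IsReversible) (q : Q) (v w : FreeGroup X) :
    M.freeAct h q (v * w) = M.freeAct h q v * M.freeAct h (M.freeRun h q v) w := by
  obtain ⟨u⟩ := v
  obtain ⟨t⟩ := w
  exact congrArg FreeGroup.mk ((M.enriched h).act_append q u t)

/-- The action of `w` on words over `Q`: the first letter `q` becomes `q · w`, and `q ∘ w` acts on
the remaining letters. -/
theorem dualHom_cons (M : MealyAutomaton Q X) (h : M.IsReversible) (w : FreeGroup X) (q : Q)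
    (s : List Q) :
    ((M.dualHom h w).unop : Equiv.Perm (List Q)) (q :: s) =
      M.freeRun h q w :: ((M.dualHom h (M.freeAct h q w)).unop : Equiv.Perm (List Q)) s := by
  have hmul : ∀ (v w : FreeGroup X) (s : List Q),
      ((M.dualHom h (v * w)).unop : Equiv.Perm (List Q)) s =
      ((M.dualHom h w).unop : Equiv.Perm (List Q)) ((M.dualHom h v).unop.1 s) := by
    intro v w s
    rw [map_mul, MulOpposite.unop_mul]
    rfl
  have hpos : ∀ (a : X) (s : List Q), (M.dualHom h (FreeGroup.of a)).unop.1 s = M.dual.act a s := by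
    intro a s
    simp only [dualHom, FreeGroup.lift_apply_of]
    rfl
  induction w using FreeGroup.induction_on generalizing q s with
  | C1 =>
    simp only [map_one, MulOpposite.unop_one]
    change q :: s = q :: ((M.dualHom h 1).unop : Equiv.Perm (List Q)) s
    simp
  | of a =>
    rw [hpos]
    change _ = _ :: (M.dualHom h (FreeGroup.of _)).unop.1 s
    rw [hpos]
    rfl
  | inv_of a _ =>
    have hinv : ∀ (b : X) (s : List Q),
        (M.dualHom h (FreeGroup.of b)⁻¹).unop.1 s = (M.dual.statePerm h b).symm s := by
      intro b s
      rw [Equiv.eq_symm_apply]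
      change M.dual.act b _ = s
      rw [← hpos, ← hmul]
      simp
    rw [hinv, Equiv.symm_apply_eq]
    have h1 := (M.letterPerm h a).apply_symm_apply q
    change _ = M.next ((M.letterPerm h a).symm q) a :: _
    have e : M.freeAct h q (FreeGroup.of a)⁻¹ =
      (FreeGroup.of (M.out ((M.letterPerm h a).symm q) a))⁻¹ := rfl
    rw [e, hinv]
    congr 1
    · exact h1.symm
    · exact ((M.dual.statePerm h _).apply_symm_apply s).symm
  | mul v w hv hw =>
    rw [hmul, hv, hw, freeAct_mul, hmul]
    congr 1
    obtain ⟨u⟩ := v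
    obtain ⟨t⟩ := w
    exact ((M.enriched h).run_append q u t).symm

theorem dualHom_nil (M : MealyAutomaton Q X) (h : M.IsReversible) (w : FreeGroup X) :
    ((M.dualHom h w).unop : Equiv.Perm (List Q)) [] = [] := by
  suffices H : ∀ g ∈ M.dual.autGroup h, g [] = [] from H _ (M.dualHom h w).unop.2
  intro g hg
  induction hg using Subgroup.closure_induction with
  | mem g hg => obtain ⟨a, rfl⟩ := hg; rfl
  | one => rfl
  | mul f g _ _ hf hg => rw [Equiv.Perm.mul_apply, hg, hf]
  | inv g _ hg => rw [Equiv.Perm.inv_eq_iff_eq, hg]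

/-- Evaluating on the empty word and on words `q :: s` separates the fixed first letter from the
action on the tail. -/
theorem mem_ker_dualHom_iff (M : MealyAutomaton Q X) (h : M.IsReversible) (w : FreeGroup X) :
    w ∈ (M.dualHom h).ker ↔
      ∀ q, M.freeAct h q w ∈ (M.dualHom h).ker ∧ M.freeRun h q w = q := by
  have key : ∀ w, w ∈ (M.dualHom h).ker ↔
      ∀ s, ((M.dualHom h w).unop : Equiv.Perm (List Q)) s = s := by
    intro w
    rw [MonoidHom.mem_ker, ← MulOpposite.unop_inj, MulOpposite.unop_one, Subtype.ext_iff,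
      Equiv.ext_iff]
    rfl
  constructor
  · intro hw q
    have hc := fun s => (M.dualHom_cons h w q s).symm.trans ((key w).1 hw (q :: s))
    simp only [List.cons.injEq] at hc
    exact ⟨(key _).2 fun s => (hc s).2, (hc []).1⟩
  · intro hw
    rw [key]
    rintro (_ | ⟨q, s⟩)
    · exact M.dualHom_nil h w
    · rw [dualHom_cons, (hw q).2, (key _).1 (hw q).1]

theorem isGreatest_ker_dualHom (M : MealyAutomaton Q X) (h : M.IsReversible) :
    IsGreatest {S : Set (FreeGroup X) | ∀ w ∈ S, ∀ q : Q, M.freeAct h q w ∈ S ∧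
      M.freeRun h q w = q} ((M.dualHom h).ker : Set (FreeGroup X)) := by
  refine ⟨fun w hw => (M.mem_ker_dualHom_iff h w).1 hw, fun S hS w hw => ?_⟩
  -- The induction on s runs over all of S at once, since w is replaced by q ∘ w on the tail.
  have key : ∀ (s : List Q), ∀ w ∈ S, ((M.dualHom h w).unop : Equiv.Perm (List Q)) s = s := by
    intro s
    induction s with
    | nil => exact fun w _ => M.dualHom_nil h w
    | cons q s ih =>
      intro w hw
      rw [dualHom_cons, (hS w hw q).2, ih _ (hS w hw q).1]
  rw [SetLike.mem_coe, MonoidHom.mem_ker]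
  exact MulOpposite.unop_injective (Subtype.ext (Equiv.ext fun s => key s w hw))

theorem dualHom_surjective (M : MealyAutomaton Q X) (h : M.IsReversible) :
    Function.Surjective (M.dualHom h) := by
  rintro ⟨⟨g, hg⟩⟩
  suffices H : ∃ w, (M.dualHom h w).unop.1 = g by
    obtain ⟨w, hw⟩ := H
    exact ⟨w, MulOpposite.unop_injective (Subtype.ext hw)⟩
  induction hg using Subgroup.closure_induction with
  | mem g hg =>
    obtain ⟨a, rfl⟩ := hg
    exact ⟨FreeGroup.of a, by simp [dualHom, gen]⟩
  | one => exact ⟨1, by simp⟩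
  | mul f g _ _ hf hg =>
    obtain ⟨v, rfl⟩ := hf
    obtain ⟨w, rfl⟩ := hg
    -- The order is reversed because `dualHom` takes values in the opposite group.
    exact ⟨w * v, by simp⟩
  | inv g _ hg =>
    obtain ⟨w, rfl⟩ := hg
    exact ⟨w⁻¹, by simp⟩

end MealyAutomaton

/-! ### Relations of the automaton group on words over X ∪ X⁻¹ -/

namespace MealyAutomaton

variable {Q X : Type*}

theorem enriched_act_map_true {M : MealyAutomaton Q X} (hM : M.IsBireversible) (q : Q)
    (u : List X) :
    (M.enriched hM.reversible).act q (u.map (·, true)) = (M.act q u).map (·, true) := by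
  induction u generalizing q with
  | nil => rfl
  | cons a u ih => exact congrArg (_ :: ·) (ih _)

/-- The free group on the states acting on words over `X`. -/
noncomputable def freeToAutGroup {M : MealyAutomaton Q X} (hM : M.IsBireversible) :
    FreeGroup Q →* M.autGroup hM.invertible :=
  FreeGroup.lift (M.gen hM.invertible)

theorem freeToAutGroup_surjective {M : MealyAutomaton Q X} (hM : M.IsBireversible) :
    Function.Surjective (freeToAutGroup hM) := by
  rintro ⟨g, hg⟩
  suffices H : ∃ w, (freeToAutGroup hM w).1 = g by
    obtain ⟨w, hw⟩ := H
    exact ⟨w, Subtype.ext hw⟩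
  induction hg using Subgroup.closure_induction with
  | mem g hg =>
    obtain ⟨a, rfl⟩ := hg
    exact ⟨FreeGroup.of a, by simp [freeToAutGroup, gen]⟩
  | one => exact ⟨1, by simp⟩
  | mul f g _ _ hf hg =>
    obtain ⟨v, rfl⟩ := hf
    obtain ⟨w, rfl⟩ := hg
    exact ⟨v * w, by simp⟩
  | inv g _ hg =>
    obtain ⟨w, rfl⟩ := hg
    exact ⟨w⁻¹, by simp⟩

/-- The automaton of formal products of states and inverses of states, the leftmost factor of a
product acting first. -/
noncomputable def wordAutomaton [Finite X] {M : MealyAutomaton Q X} (hM : M.IsBireversible) :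
    MealyAutomaton (List (Q × Bool)) (X × Bool) where
  next g x := ((M.enriched hM.reversible).dual.enriched hM.enriched_isInvertible).act x g
  out g x := ((M.enriched hM.reversible).dual.enriched hM.enriched_isInvertible).run x g

variable [Finite X] {M : MealyAutomaton Q X} (hM : M.IsBireversible)

theorem wordAutomaton_act_append (g k : List (Q × Bool)) (u : List (X × Bool)) :
    (wordAutomaton hM).act (g ++ k) u = (wordAutomaton hM).act k ((wordAutomaton hM).act g u) := by
  induction u generalizing g k with
  | nil => rfl
  | cons x u ih =>
    simp only [act, wordAutomaton, run_append, act_append, List.cons.injEq, true_and]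
    exact ih _ _

theorem wordAutomaton_act_nil (u : List (X × Bool)) : (wordAutomaton hM).act [] u = u := by
  induction u with
  | nil => rfl
  | cons x u ih => exact congrArg (x :: ·) ih

theorem wordAutomaton_act_pos (q : Q) (u : List (X × Bool)) :
    (wordAutomaton hM).act [(q, true)] u = enrichedPerm hM q u := by
  induction u generalizing q with
  | nil => rfl
  | cons x u ih => exact congrArg (_ :: ·) (ih _)

theorem wordAutomaton_act_neg (q : Q) (u : List (X × Bool)) :
    (wordAutomaton hM).act [(q, false)] (enrichedPerm hM q u) = u := by
  induction u generalizing q with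
  | nil => rfl
  | cons x u ih =>
    have hx : ((M.enriched hM.reversible).dual.letterPerm hM.enriched_isInvertible q).symm
        ((M.enriched hM.reversible).out q x) = x :=
      ((M.enriched hM.reversible).dual.letterPerm hM.enriched_isInvertible q).symm_apply_apply x
    have hnext : (wordAutomaton hM).next [(q, false)] ((M.enriched hM.reversible).out q x) =
        [((M.enriched hM.reversible).next q x, false)] := by
      change [((M.enriched hM.reversible).next q
        (((M.enriched hM.reversible).dual.letterPerm hM.enriched_isInvertible q).symm
        ((M.enriched hM.reversible).out q x)), false)] = _
      rw [hx]
    change _ :: (wordAutomaton hM).act ((wordAutomaton hM).next [(q, false)]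
      ((M.enriched hM.reversible).out q x))
        (enrichedPerm hM ((M.enriched hM.reversible).next q x) u) = _
    rw [hnext, ih]
    exact congrArg (· :: u) hx

/-- Verified for a single factor, then passed along the product. For an inverse factor, the letter
is first written as an output of the state. -/
theorem wordAutomaton_cancel (g : List (Q × Bool)) (x : X × Bool) :
    (wordAutomaton hM).next ((wordAutomaton hM).next g x) (x.1, !x.2) = g ∧
    (wordAutomaton hM).out ((wordAutomaton hM).next g x) (x.1, !x.2) =
      (((wordAutomaton hM).out g x).1, !((wordAutomaton hM).out g x).2) := by
  set W := (M.enriched hM.reversible).dual.enriched hM.enriched_isInvertible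
  have letter : ∀ (x : X × Bool) (r : Q × Bool), W.out (x.1, !x.2) (W.out x r) = r ∧
      W.next (x.1, !x.2) (W.out x r) = ((W.next x r).1, !(W.next x r).2) := by
    rintro x ⟨q, _ | _⟩
    · obtain ⟨y, rfl⟩ := (hM.enriched_isInvertible q).2 x
      have hsymm : ∀ p y, ((M.enriched hM.reversible).dual.letterPerm
          hM.enriched_isInvertible p).symm ((M.enriched hM.reversible).out p y) = y :=
        fun p y => ((M.enriched hM.reversible).dual.letterPerm
          hM.enriched_isInvertible p).symm_apply_apply y
      obtain ⟨h1, h2, h3⟩ := M.enriched_cancel hM.reversible q y.1 y.2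
      have e1 : W.next ((M.enriched hM.reversible).out q y) (q, false) = y := hsymm q y
      have e2 : W.out ((M.enriched hM.reversible).out q y) (q, false) =
          ((M.enriched hM.reversible).next q y, false) := by
        change ((M.enriched hM.reversible).next q (((M.enriched hM.reversible).dual.letterPerm
          hM.enriched_isInvertible q).symm ((M.enriched hM.reversible).out q y)), false) = _
        rw [hsymm]
      have h3' : ((M.enriched hM.reversible).out q y).2 = y.2 := h3
      have e3 : ((M.enriched hM.reversible).dual.letterPerm hM.enriched_isInvertible
          ((M.enriched hM.reversible).next q y)).symm
          (((M.enriched hM.reversible).out q y).1, !((M.enriched hM.reversible).out q y).2) =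
          (y.1, !y.2) := by
        rw [h3', ← h2]
        exact hsymm _ _
      rw [e1, e2]
      refine ⟨?_, e3⟩
      change ((M.enriched hM.reversible).next ((M.enriched hM.reversible).next q y)
        (((M.enriched hM.reversible).dual.letterPerm hM.enriched_isInvertible _).symm _), false) = _
      rw [e3, h1]
    · obtain ⟨h1, h2, h3⟩ := M.enriched_cancel hM.reversible q x.1 x.2
      refine ⟨congrArg (·, true) h1, h2.trans ?_⟩
      have h3' : ((M.enriched hM.reversible).out q x).2 = x.2 := h3
      exact congrArg (fun b => (_, !b)) h3'.symm
  induction g generalizing x with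
  | nil => exact ⟨rfl, rfl⟩
  | cons r g ih =>
    obtain ⟨h1, h2⟩ := letter x r
    obtain ⟨h3, h4⟩ := ih (W.next x r)
    constructor
    · change W.out (x.1, !x.2) (W.out x r) :: W.act (W.next (x.1, !x.2) (W.out x r))
        (W.act (W.next x r) g) = _
      rw [h1, h2]
      exact congrArg (r :: ·) h3
    · change W.run (W.next (x.1, !x.2) (W.out x r)) (W.act (W.next x r) g) = _
      rw [h2]
      exact h4

theorem wordAutomaton_out_snd (g : List (Q × Bool)) (x : X × Bool) :
    ((wordAutomaton hM).out g x).2 = x.2 := by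
  set W := (M.enriched hM.reversible).dual.enriched hM.enriched_isInvertible
  induction g generalizing x with
  | nil => rfl
  | cons r g ih =>
    refine (ih (W.next x r)).trans ?_
    obtain ⟨q, _ | _⟩ := r
    · obtain ⟨y, rfl⟩ := (hM.enriched_isInvertible q).2 x
      have e1 : W.next ((M.enriched hM.reversible).out q y) (q, false) = y :=
        ((M.enriched hM.reversible).dual.letterPerm hM.enriched_isInvertible q).symm_apply_apply y
      rw [e1]
      exact (M.enriched_cancel hM.reversible q y.1 y.2).2.2.symm
    · exact (M.enriched_cancel hM.reversible q x.1 x.2).2.2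

/-- A product of states and inverses of states that acts trivially on the words over `X` acts
trivially on the words over `X ∪ X⁻¹`. -/
theorem wordAutomaton_act_eq_self [Finite Q] (g : List (Q × Bool))
    (hg : ∀ u : List X, (wordAutomaton hM).act g (u.map (·, true)) = u.map (·, true))
    (u : List (X × Bool)) : (wordAutomaton hM).act g u = u := by
  have step : ∀ (g : List (Q × Bool)),
      (∀ u : List X, (wordAutomaton hM).act g (u.map (·, true)) = u.map (·, true)) → ∀ a,
      (∀ u : List X, (wordAutomaton hM).act ((wordAutomaton hM).next g (a, true))
        (u.map (·, true)) = u.map (·, true)) := by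
    intro g hg a u
    exact (List.cons.inj (hg (a :: u))).2
  have out_eq : ∀ (g : List (Q × Bool)),
      (∀ u : List X, (wordAutomaton hM).act g (u.map (·, true)) = u.map (·, true)) → ∀ a,
      (wordAutomaton hM).out g (a, true) = (a, true) := by
    intro g hg a
    exact (List.cons.inj (hg [a])).1
  -- Reading a is injective on the finitely many products of the length of g, so g = f^[n+1] g for
  -- some n. Reading a⁻¹ undoes one step and yields f^[n] g.
  have inv_step : ∀ (g : List (Q × Bool)) (a : X), ∃ j : ℕ,
      (wordAutomaton hM).next g (a, false) =
        (fun k => (wordAutomaton hM).next k (a, true))^[j] g := by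
    intro g a
    set f := fun k => (wordAutomaton hM).next k (a, true) with hf
    have hlen : ∀ k, (f k).length = k.length := fun k => act_length _ _ _
    have hleft : ∀ k, (wordAutomaton hM).next (f k) (a, false) = k :=
      fun k => (wordAutomaton_cancel hM k (a, true)).1
    have hinj : Function.Injective f := Function.LeftInverse.injective hleft
    have : Finite {k : List (Q × Bool) // k.length = g.length} :=
      (List.finite_length_eq (Q × Bool) g.length).to_subtype
    have hlen' : ∀ j, (f^[j] g).length = g.length := by
      intro j
      induction j with
      | zero => rfl
      | succ j ih => rw [Function.iterate_succ_apply', hlen, ih]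
    obtain ⟨i, j, hij, h⟩ := Finite.exists_ne_map_eq_of_infinite
      (fun j : ℕ => (⟨f^[j] g, hlen' j⟩ : {k : List (Q × Bool) // k.length = g.length}))
    have h : f^[i] g = f^[j] g := congrArg Subtype.val h
    have main : ∀ i j, i < j → f^[i] g = f^[j] g →
        ∃ n, (wordAutomaton hM).next g (a, false) = f^[n] g := by
      intro i j hij h
      obtain ⟨n, rfl⟩ := Nat.exists_eq_add_of_lt hij
      rw [add_assoc, Function.iterate_add_apply] at h
      have h' := hinj.iterate i h
      refine ⟨n, ?_⟩
      conv_lhs => rw [h', Function.iterate_succ_apply', hleft]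
    rcases lt_or_gt_of_ne hij with hij | hij
    · exact main i j hij h
    · exact main j i hij h.symm
  induction u generalizing g with
  | nil => rfl
  | cons x u ih =>
    obtain ⟨a, _ | _⟩ := x
    · have hk : ∀ u : List X, (wordAutomaton hM).act ((wordAutomaton hM).next g (a, false))
          (u.map (·, true)) = u.map (·, true) := by
        obtain ⟨j, hj⟩ := inv_step g a
        rw [hj]
        clear hj
        induction j with
        | zero => exact hg
        | succ j ihj =>
          rw [Function.iterate_succ_apply']
          exact step _ ihj a
      -- The product reached by a⁻¹ fixes a, and its output there is inverse to the output of g on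
      -- a⁻¹; hence g fixes a⁻¹.
      have h1 := (wordAutomaton_cancel hM g (a, false)).2
      have h2 := out_eq _ hk a
      have h3 := wordAutomaton_out_snd hM g (a, false)
      have h4 : (wordAutomaton hM).out g (a, false) = (a, false) := by
        refine Prod.ext ?_ h3
        exact (Prod.ext_iff.1 (h1.symm.trans h2)).1
      simp only [act, h4, ih _ hk]
    · simp only [act, out_eq g hg a, ih _ (step g hg a)]

/-- The free group on the states acting on words over `X ∪ X⁻¹`. -/
noncomputable def freeToEnrichedPerm : FreeGroup Q →* Equiv.Perm (List (X × Bool)) :=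
  FreeGroup.lift (enrichedPerm hM)

theorem freeToEnrichedPerm_map_true (w : FreeGroup Q) (u : List X) :
    freeToEnrichedPerm hM w (u.map (·, true)) = ((freeToAutGroup hM w).1 u).map (·, true) := by
  induction w using FreeGroup.induction_on generalizing u with
  | C1 => simp
  | of q =>
    simp only [freeToEnrichedPerm, freeToAutGroup, FreeGroup.lift_apply_of]
    exact enriched_act_map_true hM q u
  | inv_of q h =>
    rw [map_inv, map_inv, Equiv.Perm.inv_eq_iff_eq, h]
    simp
  | mul v w hv hw => simp [hv, hw]

theorem exists_freeToEnrichedPerm_eq_act (w : FreeGroup Q) :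
    ∃ g, ∀ u, freeToEnrichedPerm hM w u = (wordAutomaton hM).act g u := by
  induction w using FreeGroup.induction_on with
  | C1 => exact ⟨[], fun u => by simp [wordAutomaton_act_nil]⟩
  | of q => exact ⟨[(q, true)], fun u => by simp [freeToEnrichedPerm, wordAutomaton_act_pos]⟩
  | inv_of q _ =>
    refine ⟨[(q, false)], fun u => ?_⟩
    rw [map_inv, Equiv.Perm.inv_eq_iff_eq]
    have : freeToEnrichedPerm hM (FreeGroup.of q) = enrichedPerm hM q := by
      simp [freeToEnrichedPerm]
    rw [this]
    obtain ⟨v, rfl⟩ := (enrichedPerm hM q).surjective u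
    rw [wordAutomaton_act_neg]
  | mul v w hv hw =>
    obtain ⟨g, hg⟩ := hv
    obtain ⟨k, hk⟩ := hw
    exact ⟨k ++ g, fun u => by simp [hg, hk, wordAutomaton_act_append]⟩

theorem freeToEnrichedPerm_length (w : FreeGroup Q) (u : List (X × Bool)) :
    (freeToEnrichedPerm hM w u).length = u.length := by
  obtain ⟨g, hg⟩ := exists_freeToEnrichedPerm_eq_act hM w
  rw [hg, act_length]

theorem freeToEnrichedPerm_of_append_eq (w : FreeGroup Q) (u v : List (X × Bool))
    (h : freeToEnrichedPerm hM w (u ++ v) = u ++ v) : freeToEnrichedPerm hM w u = u := by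
  obtain ⟨g, hg⟩ := exists_freeToEnrichedPerm_eq_act hM w
  rw [hg] at h ⊢
  rw [act_append] at h
  exact (List.append_inj h (act_length _ _ _)).1

theorem freeToEnrichedPerm_eq_one [Finite Q] {w : FreeGroup Q} (hw : freeToAutGroup hM w = 1) :
    freeToEnrichedPerm hM w = 1 := by
  obtain ⟨g, hg⟩ := exists_freeToEnrichedPerm_eq_act hM w
  ext1 u
  rw [hg]
  refine wordAutomaton_act_eq_self hM g (fun u => ?_) u
  rw [← hg, freeToEnrichedPerm_map_true, hw]
  rfl

end MealyAutomaton

/-! ### Conjugation without cancellation -/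

namespace FreeGroup

variable {α : Type*}

/-- Over at least two letters, every reduced word can be extended to a reduced word conjugating a
given nontrivial element without cancellation. -/
theorem exists_isReduced_conj [Nontrivial α] {u m : List (α × Bool)} (hu : IsReduced u)
    (hm : IsReduced m) (hm0 : m ≠ []) :
    ∃ z : α × Bool, IsReduced (u ++ [z] ++ m ++ invRev (u ++ [z])) := by
  obtain ⟨a, b, hab⟩ := exists_pair_ne α
  -- Three letters are forbidden, one for each junction u·z, z·m and m·z⁻¹, while two generators and
  -- their inverses supply four.
  have hz : ∃ z : α × Bool, (∀ y ∈ u.getLast?, z ≠ (y.1, !y.2)) ∧ (∀ y ∈ m.head?, z ≠ (y.1, !y.2)) ∧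
      ∀ y ∈ m.getLast?, z ≠ y := by
    classical
    set s : List (α × Bool) := (u.getLast?.map fun y => (y.1, !y.2)).toList ++
      (m.head?.map fun y => (y.1, !y.2)).toList ++ m.getLast?.toList with hs
    have hcard : s.toFinset.card < ({(a, true), (a, false), (b, true), (b, false)} :
        Finset (α × Bool)).card := by
      refine lt_of_le_of_lt (List.toFinset_card_le s) ?_
      have h4 : ({(a, true), (a, false), (b, true), (b, false)} : Finset (α × Bool)).card = 4 := by
        rw [Finset.card_insert_of_notMem, Finset.card_insert_of_notMem, Finset.card_pair] <;>
          simp [hab]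
      rw [h4, hs]
      have : ∀ o : Option (α × Bool), o.toList.length ≤ 1 := by rintro (_ | _) <;> simp
      have h1 := this (u.getLast?.map fun y => (y.1, !y.2))
      have h2 := this (m.head?.map fun y => (y.1, !y.2))
      have h3 := this m.getLast?
      simp only [List.length_append]
      omega
    obtain ⟨z, -, hzs⟩ := Finset.exists_mem_notMem_of_card_lt_card hcard
    refine ⟨z, fun y hy h => hzs ?_, fun y hy h => hzs ?_, fun y hy h => hzs ?_⟩ <;>
    · subst h
      rw [Option.mem_def] at hy
      simp [hs, hy]
  obtain ⟨z, hz1, hz2, hz3⟩ := hz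
  have ne_inv : ∀ x y : α × Bool, x ≠ (y.1, !y.2) → y.1 = x.1 → y.2 = x.2 := by
    rintro ⟨x1, x2⟩ ⟨y1, y2⟩ h1 h2
    simp only at h2
    subst h2
    cases x2 <;> cases y2 <;> simp_all
  have huz : IsReduced (u ++ [z]) := by
    rw [IsReduced, List.isChain_append]
    refine ⟨hu, List.isChain_singleton _, fun y hy x hx => ?_⟩
    obtain rfl : z = x := by simpa using hx
    exact ne_inv _ _ (hz1 y hy)
  have hinv : IsReduced (invRev (u ++ [z])) := by
    classical
    rw [isReduced_iff_reduce_eq, reduce_invRev, huz.reduce_eq]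
  refine ⟨z, ?_⟩
  rw [IsReduced, List.isChain_append, List.isChain_append]
  refine ⟨⟨huz, hm, fun x hx y hy => ?_⟩, hinv, fun x hx y hy => ?_⟩
  · obtain rfl : z = x := by simpa using hx
    intro h
    have := ne_inv _ _ (hz2 y hy) h.symm
    exact this.symm
  · rw [List.getLast?_append_of_ne_nil _ hm0] at hx
    obtain rfl : (z.1, !z.2) = y := by simpa [invRev] using hy
    intro h
    have h3 := hz3 x hx
    obtain ⟨z1, z2⟩ := z
    obtain ⟨x1, x2⟩ := x
    simp only at h
    subst h
    cases x2 <;> cases z2 <;> simp_all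

end FreeGroup

/-! ### Automorphisms of the kernel -/

namespace MealyAutomaton

/-- A trivial kernel would identify the free group on X with the opposite of the dual group, which
inversion identifies with the dual group itself. -/
theorem ker_dualHom_ne_bot {Q X : Type*} (M : MealyAutomaton Q X) (h : M.IsReversible)
    (hfree : ¬ IsFreeGroup (M.dual.autGroup h)) : (M.dualHom h).ker ≠ ⊥ := by
  intro hbot
  have e := MulEquiv.ofBijective (M.dualHom h)
    ⟨(MonoidHom.ker_eq_bot_iff _).1 hbot, M.dualHom_surjective h⟩
  exact hfree (IsFreeGroup.ofMulEquiv (e.trans (MulEquiv.inv' _).symm))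

variable {Q X : Type*} [Finite X] {M : MealyAutomaton Q X} (hM : M.IsBireversible)

/-- The endomorphism of the kernel of `dualHom` given by a state. -/
noncomputable def kerEnd (q : Q) :
    (M.dualHom hM.reversible).ker →* (M.dualHom hM.reversible).ker where
  toFun n := ⟨M.freeAct hM.reversible q n, ((M.mem_ker_dualHom_iff hM.reversible n).1 n.2 q).1⟩
  map_one' := rfl
  map_mul' m n := Subtype.ext <| by
    have := ((M.mem_ker_dualHom_iff hM.reversible m).1 m.2 q).2
    simp only [Subgroup.coe_mul, freeAct_mul, this]

theorem finite_setOf_norm_eq [DecidableEq X] (N : Subgroup (FreeGroup X)) (k : ℕ) :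
    {n : N | (n : FreeGroup X).norm = k}.Finite :=
  Set.Finite.of_injOn (f := fun n : N => (n : FreeGroup X).toWord)
    (t := {l : List (X × Bool) | l.length = k}) (fun _ h => h)
    (fun _ _ _ _ h => Subtype.ext (FreeGroup.toWord_injective h))
    (List.finite_length_eq (X × Bool) k)

/-- An injective length-preserving map is surjective on each finite set of kernel elements of given
length. -/
theorem kerEnd_bijective (q : Q) : Function.Bijective (kerEnd hM q) := by
  classical
  have hnorm : ∀ n, (kerEnd hM q n : FreeGroup X).norm = (n : FreeGroup X).norm := by
    intro n
    change (M.freeAct hM.reversible q n).toWord.length = _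
    rw [toWord_freeAct hM, act_length]
    rfl
  have hinj : Function.Injective (kerEnd hM q) := by
    intro m n h
    have h' : M.freeAct hM.reversible q m = M.freeAct hM.reversible q n := congrArg Subtype.val h
    have h'' := congrArg FreeGroup.toWord h'
    rw [toWord_freeAct hM, toWord_freeAct hM] at h''
    exact Subtype.ext (FreeGroup.toWord_injective ((enrichedPerm hM q).injective h''))
  refine ⟨hinj, fun n => ?_⟩
  have hfin : Finite {m : (M.dualHom hM.reversible).ker //
      (m : FreeGroup X).norm = (n : FreeGroup X).norm} := (finite_setOf_norm_eq _ _).to_subtype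
  obtain ⟨m, hm⟩ := Finite.surjective_of_injective
    (f := fun m : {m : (M.dualHom hM.reversible).ker //
      (m : FreeGroup X).norm = (n : FreeGroup X).norm} =>
        (⟨kerEnd hM q m.1, (hnorm m.1).trans m.2⟩ : {m : (M.dualHom hM.reversible).ker //
          (m : FreeGroup X).norm = (n : FreeGroup X).norm}))
    (fun a b h => Subtype.ext (hinj (congrArg Subtype.val h))) ⟨n, rfl⟩
  exact ⟨m.1, congrArg Subtype.val hm⟩

/-- The free group on the states acting by automorphisms on the kernel of `dualHom`. -/
noncomputable def freeToMulAut :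
    FreeGroup Q →* MulAut (M.dualHom hM.reversible).ker :=
  FreeGroup.lift fun q => MulEquiv.ofBijective (kerEnd hM q) (kerEnd_bijective hM q)

theorem toWord_freeToMulAut [DecidableEq X] (w : FreeGroup Q) (n : (M.dualHom hM.reversible).ker) :
    (freeToMulAut hM w n : FreeGroup X).toWord =
      freeToEnrichedPerm hM w (n : FreeGroup X).toWord := by
  induction w using FreeGroup.induction_on generalizing n with
  | C1 => simp
  | of q =>
    simp only [freeToMulAut, freeToEnrichedPerm, FreeGroup.lift_apply_of]
    exact toWord_freeAct hM q _
  | inv_of q h =>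
    rw [map_inv, map_inv, eq_comm, Equiv.Perm.inv_eq_iff_eq, ← h]
    congr 2
    exact ((freeToMulAut hM (FreeGroup.of q)).apply_symm_apply n).symm
  | mul v w hv hw => simp [hv, hw]

/-- The automaton group acting by automorphisms on the kernel of `dualHom`. -/
noncomputable def autGroupToMulAut [Finite Q] :
    M.autGroup hM.invertible →* MulAut (M.dualHom hM.reversible).ker :=
  (freeToAutGroup hM).liftOfSurjective (freeToAutGroup_surjective hM)
    ⟨freeToMulAut hM, fun w hw => by
      classical
      rw [MonoidHom.mem_ker] at hw ⊢
      ext1 n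
      refine Subtype.ext (FreeGroup.toWord_injective ?_)
      rw [toWord_freeToMulAut, freeToEnrichedPerm_eq_one hM hw]
      rfl⟩

theorem autGroupToMulAut_apply [Finite Q] (w : FreeGroup Q) :
    autGroupToMulAut hM (freeToAutGroup hM w) = freeToMulAut hM w :=
  MonoidHom.liftOfRightInverse_comp_apply _ _ _ _ w

theorem norm_autGroupToMulAut [Finite Q] [DecidableEq X] (g : M.autGroup hM.invertible)
    (n : (M.dualHom hM.reversible).ker) :
    (autGroupToMulAut hM g n : FreeGroup X).norm = (n : FreeGroup X).norm := by
  obtain ⟨w, rfl⟩ := freeToAutGroup_surjective hM g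
  rw [autGroupToMulAut_apply, FreeGroup.norm, toWord_freeToMulAut, freeToEnrichedPerm_length]
  rfl

/-- Over at most one letter a word is determined by its length, which the group preserves. -/
theorem nontrivial_of_infinite_autGroup (M : MealyAutomaton Q X) (hM : M.IsBireversible)
    [Infinite (M.autGroup hM.invertible)] : Nontrivial X := by
  by_contra hX
  rw [not_nontrivial_iff_subsingleton] at hX
  suffices Subsingleton (M.autGroup hM.invertible) from
    not_finite (M.autGroup hM.invertible)
  refine subsingleton_of_forall_eq 1 fun g => ?_
  obtain ⟨w, rfl⟩ := freeToAutGroup_surjective hM g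
  refine Subtype.ext (Equiv.ext fun u => ?_)
  have hlen : ((freeToAutGroup hM w).1 u).length = u.length := by
    have := congrArg List.length (freeToEnrichedPerm_map_true hM w u)
    rw [freeToEnrichedPerm_length] at this
    simpa using this.symm
  exact List.ext_getElem hlen fun _ _ _ => Subsingleton.elim _ _

/-! ### Consequences of a nontrivial kernel -/

section

variable [Nontrivial X] (hbot : (M.dualHom hM.reversible).ker ≠ ⊥)
include hbot

omit [Finite X] in
/-- Every reduced word is a prefix of an element of the kernel of `dualHom`, which becomes shorter
by twice the length of the word when the word is cancelled on both sides. -/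
theorem exists_mem_ker_toWord [DecidableEq X] {u : List (X × Bool)} (hu : FreeGroup.IsReduced u) :
    ∃ n : (M.dualHom hM.reversible).ker, ∃ v, (n : FreeGroup X).toWord = u ++ v ∧
      ((FreeGroup.mk u)⁻¹ * n * FreeGroup.mk u).norm + 2 * u.length =
        (n : FreeGroup X).norm := by
  obtain ⟨⟨m, hmN⟩, hm⟩ := Subgroup.ne_bot_iff_exists_ne_one.1 hbot
  have hm1 : m ≠ 1 := fun h => hm (Subtype.ext h)
  obtain ⟨z, hz⟩ := FreeGroup.exists_isReduced_conj hu (FreeGroup.isReduced_toWord (x := m))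
    (by simpa using hm1)
  have hz' : FreeGroup.IsReduced ([z] ++ m.toWord ++ FreeGroup.invRev [z]) :=
    hz.infix ⟨u, FreeGroup.invRev u, by simp [FreeGroup.invRev]⟩
  have e : ∀ t : List (X × Bool), FreeGroup.mk (t ++ m.toWord ++ FreeGroup.invRev t) =
      FreeGroup.mk t * m * (FreeGroup.mk t)⁻¹ := by
    intro t
    rw [← FreeGroup.mul_mk, ← FreeGroup.mul_mk, FreeGroup.mk_toWord, FreeGroup.inv_mk]
  have e2 : (FreeGroup.mk (u ++ [z] ++ m.toWord ++ FreeGroup.invRev (u ++ [z]))).toWord =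
      u ++ [z] ++ m.toWord ++ FreeGroup.invRev (u ++ [z]) := by
    rw [FreeGroup.toWord_mk, hz.reduce_eq]
  refine ⟨⟨FreeGroup.mk (u ++ [z] ++ m.toWord ++ FreeGroup.invRev (u ++ [z])), ?_⟩,
    [z] ++ m.toWord ++ FreeGroup.invRev (u ++ [z]), ?_, ?_⟩
  · rw [e]
    exact (MonoidHom.normal_ker _).conj_mem _ hmN _
  · exact e2.trans (by simp only [List.append_assoc])
  · have e3 : (FreeGroup.mk u)⁻¹ * FreeGroup.mk (u ++ [z] ++ m.toWord ++
        FreeGroup.invRev (u ++ [z])) * FreeGroup.mk u =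
        FreeGroup.mk ([z] ++ m.toWord ++ FreeGroup.invRev [z]) := by
      rw [e, e, ← FreeGroup.mul_mk]
      group
    rw [e3, FreeGroup.norm, FreeGroup.norm, FreeGroup.toWord_mk, hz'.reduce_eq, e2]
    simp
    omega

/-- A positive word is reduced, hence a prefix of some kernel element; an automorphism fixing that
element fixes the prefix. -/
theorem autGroupToMulAut_injective [Finite Q] : Function.Injective (autGroupToMulAut hM) := by
  classical
  rw [injective_iff_map_eq_one]
  intro g hg
  obtain ⟨w, rfl⟩ := freeToAutGroup_surjective hM g
  rw [autGroupToMulAut_apply] at hg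
  refine Subtype.ext (Equiv.ext fun u => ?_)
  have hu : FreeGroup.IsReduced (u.map (·, true)) := by
    rw [FreeGroup.IsReduced, List.isChain_map]
    induction u with
    | nil => simp
    | cons a u ih => cases u <;> simp_all
  obtain ⟨n, v, hn, -⟩ := exists_mem_ker_toWord hM hbot hu
  have h := toWord_freeToMulAut hM w n
  rw [hg, hn, MulAut.one_apply, hn] at h
  have h' := freeToEnrichedPerm_of_append_eq hM w _ _ h.symm
  rw [freeToEnrichedPerm_map_true] at h'
  exact List.map_injective_iff.2 (fun a b h => (Prod.mk.inj h).1) h'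

theorem autGroupToMulAut_notMem_inn [Finite Q] (g : M.autGroup hM.invertible) (hg : g ≠ 1) :
    autGroupToMulAut hM g ∉ Inn (M.dualHom hM.reversible).ker := by
  classical
  rintro ⟨k, hk⟩
  have hk1 : k = 1 := by
    obtain ⟨n, -, -, hn⟩ := exists_mem_ker_toWord hM hbot
      (FreeGroup.isReduced_toWord (x := (k : FreeGroup X)))
    -- Conjugation by k takes this element to n, which is longer by twice the length of k.
    have h := norm_autGroupToMulAut hM g (k⁻¹ * n * k)
    rw [← hk, MulAut.conj_apply, FreeGroup.mk_toWord] at *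
    have e : k * (k⁻¹ * n * k) * k⁻¹ = n := by group
    rw [e] at h
    simp only [Subgroup.coe_mul, Subgroup.coe_inv] at h
    have : (k : FreeGroup X).toWord.length = 0 := by omega
    exact Subtype.ext (FreeGroup.norm_eq_zero.1 this)
  refine hg (autGroupToMulAut_injective hM hbot ?_)
  rw [← hk, hk1, map_one, map_one]

/-- An automorphism is determined by the images of the generators, and each image lies in a finite
set of elements of fixed length. -/
theorem not_fg_ker_dualHom [Finite Q] [Infinite (M.autGroup hM.invertible)] :
    ¬ Group.FG (M.dualHom hM.reversible).ker := by
  classical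
  intro hfg
  obtain ⟨S, hS⟩ := Group.fg_def.1 hfg
  have hfin : ∀ k : ℕ, Finite {n : (M.dualHom hM.reversible).ker // (n : FreeGroup X).norm = k} :=
    fun k => (finite_setOf_norm_eq _ k).to_subtype
  let f : M.autGroup hM.invertible → ∀ s : S, {n : (M.dualHom hM.reversible).ker //
      (n : FreeGroup X).norm = (s.1 : FreeGroup X).norm} :=
    fun g s => ⟨autGroupToMulAut hM g s, norm_autGroupToMulAut hM g s⟩
  have hf : Function.Injective f := by
    intro g k hgk
    refine autGroupToMulAut_injective hM hbot ?_
    have : (autGroupToMulAut hM g).toMonoidHom = (autGroupToMulAut hM k).toMonoidHom :=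
      MonoidHom.eq_of_eqOn_dense hS fun s hs => congrArg Subtype.val (congrFun hgk ⟨s, hs⟩)
    exact MulEquiv.toMonoidHom_injective this
  exact not_finite_iff_infinite.2 ‹_› (Finite.of_injective f hf)

end

end MealyAutomaton

/-- A countable free group that is not finitely generated is free of countably infinite rank. -/
theorem IsFreeGroup.nonempty_mulEquiv_freeGroup_nat (G : Type*) [Group G] [IsFreeGroup G]
    [Countable G] (hG : ¬ Group.FG G) : Nonempty (G ≃* FreeGroup ℕ) := by
  have hinf : Infinite (IsFreeGroup.Generators G) := by
    by_contra h
    rw [not_infinite_iff_finite] at h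
    exact hG (Group.fg_of_surjective (f := (IsFreeGroup.mulEquiv G).toMonoidHom)
      (IsFreeGroup.mulEquiv G).surjective)
  have hcount : Countable (IsFreeGroup.Generators G) :=
    (IsFreeGroup.basis G).injective.countable
  obtain ⟨e⟩ := nonempty_equiv_of_countable (α := IsFreeGroup.Generators G) (β := ℕ)
  exact ⟨(IsFreeGroup.toFreeGroup G).trans (FreeGroup.freeGroupCongr e)⟩

/-! ### The embedding into Out(F_∞) -/

theorem mainTheorem11 {Q X : Type*} [Finite Q] [Finite X] (M : MealyAutomaton Q X)
    (hM : M.IsBireversible) (hinf : Infinite (M.autGroup hM.invertible))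
    (hfree : ¬ IsFreeGroup (M.dual.autGroup hM.reversible)) :
    ∃ N : Subgroup (FreeGroup X),
      IsGreatest
        {S : Set (FreeGroup X) | ∀ w ∈ S, ∀ q : Q,
          M.freeAct hM.reversible q w ∈ S ∧ M.freeRun hM.reversible q w = q}
        (N : Set (FreeGroup X)) ∧
      N = (M.dualHom hM.reversible).ker ∧
      N.Normal ∧
      N.index = 0 ∧
      ∃ (e : N ≃* FreeGroup ℕ) (ψ : M.autGroup hM.invertible →* MulAut N)
        (φ : M.autGroup hM.invertible →* Out (FreeGroup ℕ)),
        (∀ (q : Q) (n : N),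
          ((ψ (M.gen hM.invertible q) n : N) : FreeGroup X) =
            M.freeAct hM.reversible q (n : FreeGroup X)) ∧
        (∀ g : M.autGroup hM.invertible, g ≠ 1 → ψ g ∉ Inn N) ∧
        (∀ g : M.autGroup hM.invertible,
          φ g = QuotientGroup.mk' (Inn (FreeGroup ℕ)) (MulAut.congr e (ψ g))) ∧
        Function.Injective φ := by
  have hX : Nontrivial X := M.nontrivial_of_infinite_autGroup hM
  have hbot := M.ker_dualHom_ne_bot hM.reversible hfree
  have hfg := MealyAutomaton.not_fg_ker_dualHom hM hbot
  have hcount : Countable (FreeGroup X) := by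
    classical
    exact FreeGroup.toWord_injective.countable
  obtain ⟨e⟩ := IsFreeGroup.nonempty_mulEquiv_freeGroup_nat (M.dualHom hM.reversible).ker hfg
  have hinn := MealyAutomaton.autGroupToMulAut_notMem_inn hM hbot
  refine ⟨(M.dualHom hM.reversible).ker, M.isGreatest_ker_dualHom hM.reversible, rfl,
    MonoidHom.normal_ker _, ?_, e, MealyAutomaton.autGroupToMulAut hM,
    (QuotientGroup.mk' (Inn (FreeGroup ℕ))).comp
      ((MulAut.congr e).toMonoidHom.comp (MealyAutomaton.autGroupToMulAut hM)), fun q n => ?_,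
    hinn, fun g => rfl, ?_⟩
  · by_contra h
    have : (M.dualHom hM.reversible).ker.FiniteIndex := ⟨h⟩
    exact hfg inferInstance
  · have hq : MealyAutomaton.freeToAutGroup hM (FreeGroup.of q) = M.gen hM.invertible q := by
      simp [MealyAutomaton.freeToAutGroup]
    rw [← hq, MealyAutomaton.autGroupToMulAut_apply]
    simp only [MealyAutomaton.freeToMulAut, FreeGroup.lift_apply_of]
    rfl
  · rw [injective_iff_map_eq_one]
    intro g hg
    by_contra hg1
    refine hinn g hg1 ?_
    obtain ⟨k, hk⟩ := (QuotientGroup.eq_one_iff _).1 hg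
    -- If the transported automorphism is conjugation by k, the original one is conjugation by the
    -- preimage of k under e.
    refine ⟨e.symm k, ?_⟩
    ext1 n
    have := DFunLike.congr_fun hk (e n)
    apply e.injective
    simpa using this
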